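/- Let $M$ be a monoid and $\Sigma$ a finite alphabet. A \emph{finite automaton over $M$} is a finite directed graph with edges labelled by elements of $M$, an initial vertex and a set of terminal vertices; it accepts those $m\in M$ for which there is a (possibly empty) path from the initial vertex to some terminal vertex whose edge labels have product $m$, in order (the empty path has label $1$). A subset of $M$ is \emph{rational} if it is the set of elements accepted by some finite automaton over $M$. An \emph{$M$-valence automaton} over $\Sigma$ is a finite automaton over $M\times\Sigma^*$. It accepts $w\in\Sigma^*$ if it accepts $(1,w)$; together with a target set $R\subseteq M$, it accepts $w$ if it accepts $(x,w)$ for some $x\in R$. Write $F_1(M)$ for the family of languages accepted by $M$-valence automata, and $F_{Rat}(M)$ for the family of languages accepted by $M$-valence automata with rational target sets. For a set $X$, the \emph{polycyclic monoid} $P(X)$ is the monoid generated, under composition from left to right, by the partial bijections $p_x : X^*\to X^*$, $w\mapsto wx$, and $q_x : X^*x\to X^*$, $wx\mapsto w$, of the free monoid $X^*$, for $x\in X$. \textbf{Theorem.} If $|X|\ge 2$, then over every finite alphabet $\Sigma$ the languages in $F_{Rat}(P(X))$ are exactly the context-free languages, and so are the languages in $F_1(P(X))$. That is, $F_{Rat}(P(X))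 = F_1(P(X)) = \mathrm{CF}$. -/

import Mathlib

/-- A finite automaton over a monoid `M`: a finite directed graph with edges labelled by elements
of `M`, an initial vertex and a set of terminal vertices. -/
structure FiniteAutomaton (M : Type*) where
  /-- The vertices. -/
  V : Type
  /-- There are finitely many vertices. -/
  finite_V : Finite V
  /-- The labelled edges `(source, label, target)`. -/
  edges : Finset (V × M × V)
  /-- The initial vertex. -/
  init : V
  /-- The terminal vertices. -/
  terminal : Set V

namespace FiniteAutomaton

/-- `A.HasPath u m v`: some path of `A` from `u` to `v` has `m` as the product, in order, of its
edge labels. The empty path has label `1`. -/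
inductive HasPath {M : Type*} [Monoid M] (A : FiniteAutomaton M) : A.V → M → A.V → Prop
  | nil (u : A.V) : HasPath A u 1 u
  | cons {u v w : A.V} {m n : M} (he : (u, m, v) ∈ A.edges) (hp : HasPath A v n w) :
      HasPath A u (m * n) w

/-- The subset of `M` accepted by `A`: the labels of paths from the initial vertex to some
terminal vertex. -/
def accepted {M : Type*} [Monoid M] (A : FiniteAutomaton M) : Set M :=
  {m | ∃ t ∈ A.terminal, A.HasPath A.init m t}

end FiniteAutomaton

/-- A subset of a monoid is rational if it is accepted by some finite automaton. -/
def IsRationalSubset {M : Type*} [Monoid M] (R : Set M) : Prop :=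
  ∃ A : FiniteAutomaton M, A.accepted = R

/-- An `M`-valence automaton over the alphabet `α` is a finite automaton over the direct product
of `M` and the free monoid on `α`. -/
abbrev ValenceAutomaton (M : Type*) (α : Type*) := FiniteAutomaton (M × FreeMonoid α)

namespace ValenceAutomaton

/-- The language accepted by an `M`-automaton with target set `R`. -/
def languageWithTarget {M : Type*} [Monoid M] {α : Type*} (A : ValenceAutomaton M α)
    (R : Set M) : Language α :=
  {w | ∃ x ∈ R, (x, FreeMonoid.ofList w) ∈ A.accepted}

/-- The language accepted by an `M`-automaton (without target set): the words `w` such that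
`(1, w)` is accepted. -/
def language {M : Type*} [Monoid M] {α : Type*} (A : ValenceAutomaton M α) : Language α :=
  {w | ((1 : M), FreeMonoid.ofList w) ∈ A.accepted}

end ValenceAutomaton

/-- The family `F_1(M)`, for languages over the alphabet `α`. -/
def familyOne (M : Type*) [Monoid M] (α : Type*) : Set (Language α) :=
  {L | ∃ A : ValenceAutomaton M α, A.language = L}

/-- The family `F_Rat(M)`, for languages over the alphabet `α`. -/
def familyRat (M : Type*) [Monoid M] (α : Type*) : Set (Language α) :=
  {L | ∃ (A : ValenceAutomaton M α) (R : Set M), IsRationalSubset R ∧ A.languageWithTarget R = L}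

/-- The partial bijections of a set `S` (bijections between subsets of `S`). -/
def PartialBijection (S : Type*) := S ≃. S

namespace PartialBijection

/-- Partial bijections form a monoid under relational composition: `f * g` is `f` followed
by `g`. -/
instance (S : Type*) : Monoid (PartialBijection S) where
  mul f g := PEquiv.trans f g
  one := PEquiv.refl S
  mul_assoc f g h := PEquiv.trans_assoc f g h
  one_mul f := PEquiv.refl_trans f
  mul_one f := PEquiv.trans_refl f

end PartialBijection

open Classical in
/-- The partial bijection `p_x : X* → X*`, `w ↦ wx`, with inverse defined on `X*x`. -/
noncomputable def polyPush {X : Type*} (x : X) : PartialBijection (List X) :=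
  show List X ≃. List X from
  { toFun := fun w => some (w ++ [x])
    invFun := fun u => if u.getLast? = some x then some u.dropLast else none
    inv := by
      intro w u
      constructor
      · intro h
        by_cases hu : u.getLast? = some x
        · simp only [hu, if_true, Option.some.injEq] at h ⊢
          rw [← h]
          exact List.dropLast_append_getLast? x hu
        · simp [hu] at h
      · intro h
        simp only [Option.some.injEq] at h
        subst h
        simp }

/-- The partial bijection `q_x : X*x → X*`, `wx ↦ w`. -/
noncomputable def polyPop {X : Type*} (x : X) : PartialBijection (List X) :=
  PEquiv.symm (polyPush x)

/-- `p_x` maps `w` to `u` exactly if `u = wx`. -/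
theorem mem_polyPush_iff {X : Type*} (x : X) (w u : List X) :
    u ∈ (show List X ≃. List X from polyPush x) w ↔ u = w ++ [x] := by
  change some (w ++ [x]) = some u ↔ _
  simp [eq_comm]

/-- `q_x` maps `u` to `w` exactly if `u = wx`. -/
theorem mem_polyPop_iff {X : Type*} (x : X) (u w : List X) :
    w ∈ (show List X ≃. List X from polyPop x) u ↔ u = w ++ [x] :=
  (PEquiv.mem_iff_mem (show List X ≃. List X from polyPush x)).trans (mem_polyPush_iff x w u)

/-- The polycyclic monoid `P(X)`: the monoid of partial bijections of `X*` generated by all `p_x`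
and `q_x`. -/
def PolycyclicMonoid (X : Type*) : Submonoid (PartialBijection (List X)) :=
  Submonoid.closure (Set.range polyPush ∪ Set.range polyPop)

/-! The monoid acts on words as on stacks whose top is the right end. A word in pushes and pops
either at some point pops a letter other than the one it pushed there, and then denotes the empty
map (zero), or it reduces to popping a word `u` and then pushing a word `v`. The pair `(u, v)` can
be read off from the map, so two words are equal in P(X) exactly if both mismatch or both have the
same normal form (`value_eq_value_iff`).

For F_Rat ⊆ CF, the edge labels of the valence automaton and of the automaton for the target set are
spelled out in single letters (`exists_reaches`). It remains to describe the input of those runs of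
the first automaton for which the second has a run of equal value. A run with normal form `(u, v)`
consists of Dyck segments separated by the pops of `u` and the pushes of `v`. A grammar whose
nonterminals are pairs of states guesses these separators for both automata at once and generates
the input of the first. The Dyck segments of the second need only exist, so they are side conditions
of the rules. The value zero needs one further condition: whether the target automaton accepts some
mismatching word.

For CF ⊆ F_1, the stack holds a sentential form, its first symbol on top, and the automaton carries
out a leftmost derivation. Two letters suffice to code all symbols that occur in the grammar.
Finally, F_1 ⊆ F_Rat by the target set {1}. -/

/-- Letters acting on a stack and a one-way input tape. -/
inductive StackLetter (X α : Type*)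
  | push (x : X)
  | pop (x : X)
  | read (a : α)

/-! ### Normal forms of stack words. -/

namespace StackLetter

variable {X α : Type*}

/-- The words with trivial effect on the stack, which they never deplete. -/
inductive Dyck : List (StackLetter X α) → Prop
  | nil : Dyck []
  | read (a : α) {l : List (StackLetter X α)} (h : Dyck l) : Dyck (read a :: l)
  | push (x : X) {d l : List (StackLetter X α)} (hd : Dyck d) (h : Dyck l) :
      Dyck (push x :: (d ++ pop x :: l))

/-- `Pushes l v`: the word `l` pushes `v` without touching the initial stack. -/
inductive Pushes : List (StackLetter X α) → List X → Prop
  | dyck {l : List (StackLetter X α)} (h : Dyck l) : Pushes l []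
  | push (x : X) {d l : List (StackLetter X α)} {v : List X} (hd : Dyck d) (h : Pushes l v) :
      Pushes (d ++ push x :: l) (x :: v)

/-- `PopsPushes l u v`: the word `l` pops the letters of `u` and then pushes those of `v`. -/
inductive PopsPushes : List (StackLetter X α) → List X → List X → Prop
  | pushes {l : List (StackLetter X α)} {v : List X} (h : Pushes l v) : PopsPushes l [] v
  | pop (x : X) {d l : List (StackLetter X α)} {u v : List X} (hd : Dyck d)
      (h : PopsPushes l u v) : PopsPushes (d ++ pop x :: l) (x :: u) v

/-- The words that pop a letter different from the one which was pushed. -/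
inductive Mismatch : List (StackLetter X α) → Prop
  | mismatch {x y : X} (hxy : x ≠ y) {d : List (StackLetter X α)} (hd : Dyck d)
      (l : List (StackLetter X α)) : Mismatch (push x :: (d ++ pop y :: l))
  | cons (a : StackLetter X α) {l : List (StackLetter X α)} (h : Mismatch l) : Mismatch (a :: l)

theorem Dyck.append {d l : List (StackLetter X α)} (hd : Dyck d) (hl : Dyck l) :
    Dyck (d ++ l) := by
  induction hd with
  | nil => exact hl
  | read a _ ih => exact ih.read a
  | push x hd _ _ ih => simpa using Dyck.push x hd ih

theorem Dyck.append_pushes {d l : List (StackLetter X α)} {v : List X} (hd : Dyck d)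
    (hl : Pushes l v) : Pushes (d ++ l) v := by
  cases hl with
  | dyck h => exact .dyck (hd.append h)
  | push x hd' h => simpa using Pushes.push x (hd.append hd') h

theorem Dyck.append_popsPushes {d l : List (StackLetter X α)} {u v : List X} (hd : Dyck d)
    (hl : PopsPushes l u v) : PopsPushes (d ++ l) u v := by
  cases hl with
  | pushes h => exact .pushes (hd.append_pushes h)
  | pop x hd' h => simpa using PopsPushes.pop x (hd.append hd') h

/-- Letters are prepended one at a time. The only interaction is a new push meeting the first
unmatched pop: equal letters enclose a Dyck word, different ones give a mismatch. -/
theorem mismatch_or_popsPushes (l : List (StackLetter X α)) :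
    Mismatch l ∨ ∃ u v, PopsPushes l u v := by
  induction l with
  | nil => exact .inr ⟨[], [], .pushes (.dyck .nil)⟩
  | cons a l ih =>
    obtain h | ⟨u, v, h⟩ := ih
    · exact .inl (h.cons a)
    cases a with
    | read a => exact .inr ⟨u, v, (Dyck.nil.read a).append_popsPushes h⟩
    | pop x => exact .inr ⟨x :: u, v, h.pop x .nil⟩
    | push x =>
      cases h with
      | pushes h => exact .inr ⟨[], x :: v, .pushes (h.push x .nil)⟩
      | @pop y d l u _ hd h =>
        by_cases hxy : x = y
        · subst hxy
          exact .inr ⟨u, v, by simpa using (Dyck.push x hd .nil).append_popsPushes h⟩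
        · exact .inl (.mismatch hxy hd l)

theorem pushes_map_push (v : List X) : Pushes (v.map (push (α := α))) v := by
  induction v with
  | nil => exact .dyck .nil
  | cons x v ih => exact ih.push x .nil

theorem popsPushes_map_pop_append_map_push (u v : List X) :
    PopsPushes (u.map (pop (α := α)) ++ v.map push) u v := by
  induction u with
  | nil => exact .pushes (pushes_map_push v)
  | cons x u ih => exact ih.pop x .nil

/-- The input consumed by a letter. -/
def letterWord : StackLetter X α → FreeMonoid α
  | push _ => 1
  | pop _ => 1
  | read a => FreeMonoid.of a

/-- The input consumed by a word. -/
def inputWord (l : List (StackLetter X α)) : List α :=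
  FreeMonoid.toList (l.map letterWord).prod

@[simp] theorem inputWord_nil : inputWord ([] : List (StackLetter X α)) = [] := rfl

@[simp] theorem inputWord_push (x : X) (l : List (StackLetter X α)) :
    inputWord (push x :: l) = inputWord l := by
  simp [inputWord, letterWord]

@[simp] theorem inputWord_pop (x : X) (l : List (StackLetter X α)) :
    inputWord (pop x :: l) = inputWord l := by
  simp [inputWord, letterWord]

@[simp] theorem inputWord_read (a : α) (l : List (StackLetter X α)) :
    inputWord (read a :: l) = a :: inputWord l := by
  simp [inputWord, letterWord]

@[simp] theorem inputWord_append (l l' : List (StackLetter X α)) :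
    inputWord (l ++ l') = inputWord l ++ inputWord l' := by
  simp [inputWord]

end StackLetter

/-! ### Equality in the polycyclic monoid. -/

namespace PolycyclicMonoid

variable {X α : Type*}

/-- `Acts m z y`: the partial bijection `m` maps `z` to `y`. -/
def Acts (m : PolycyclicMonoid X) (z y : List X) : Prop :=
  y ∈ (show List X ≃. List X from m.1) z

theorem acts_one {z y : List X} : Acts 1 z y ↔ y = z := by
  change y ∈ PEquiv.refl (List X) z ↔ _
  simp [eq_comm]

theorem acts_mul {m n : PolycyclicMonoid X} {z y : List X} :
    Acts (m * n) z y ↔ ∃ k, Acts m z k ∧ Acts n k y :=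
  PEquiv.mem_trans _ _ _ _

theorem Acts.unique {m : PolycyclicMonoid X} {z y y' : List X} (h : Acts m z y)
    (h' : Acts m z y') : y = y' :=
  Option.mem_unique h h'

theorem ext_acts {m n : PolycyclicMonoid X} (h : ∀ z y, Acts m z y ↔ Acts n z y) : m = n := by
  apply Subtype.ext
  refine PEquiv.ext (f := (show List X ≃. List X from m.1)) fun z => Option.ext fun y => h z y

/-- The generator `p_x`. -/
noncomputable def push (x : X) : PolycyclicMonoid X :=
  ⟨polyPush x, Submonoid.subset_closure (.inl ⟨x, rfl⟩)⟩

/-- The generator `q_x`. -/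
noncomputable def pop (x : X) : PolycyclicMonoid X :=
  ⟨polyPop x, Submonoid.subset_closure (.inr ⟨x, rfl⟩)⟩

theorem acts_push {x : X} {z y : List X} : Acts (push x) z y ↔ y = z ++ [x] :=
  mem_polyPush_iff x z y

theorem acts_pop {x : X} {z y : List X} : Acts (pop x) z y ↔ z = y ++ [x] :=
  mem_polyPop_iff x z y

/-- The effect of a letter on the stack. -/
noncomputable def letterValue : StackLetter X α → PolycyclicMonoid X
  | .push x => push x
  | .pop x => pop x
  | .read _ => 1

/-- The effect of a word on the stack. -/
noncomputable def value (l : List (StackLetter X α)) : PolycyclicMonoid X :=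
  (l.map letterValue).prod

theorem value_cons (a : StackLetter X α) (l : List (StackLetter X α)) :
    value (a :: l) = letterValue a * value l := by
  simp [value]

theorem value_append (l l' : List (StackLetter X α)) :
    value (l ++ l') = value l * value l' := by
  simp [value]

theorem push_mul_pop (x : X) : push x * pop x = 1 := by
  refine ext_acts fun z y => ?_
  simp [acts_mul, acts_push, acts_pop, acts_one, eq_comm]

theorem value_dyck {l : List (StackLetter X α)} (h : StackLetter.Dyck l) : value l = 1 := by
  induction h with
  | nil => rfl
  | read a _ ih => simp [value_cons, letterValue, ih]
  | push x _ _ ihd ih => simp [value_cons, value_append, letterValue, ihd, ih, push_mul_pop]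

theorem acts_value_pushes {l : List (StackLetter X α)} {v : List X}
    (h : StackLetter.Pushes l v) {z y : List X} : Acts (value l) z y ↔ y = z ++ v := by
  induction h generalizing z y with
  | dyck h => simp [value_dyck h, acts_one]
  | push x hd _ ih =>
    simp [value_append, value_cons, value_dyck hd, letterValue, acts_mul, acts_push, ih]

theorem acts_value_popsPushes {l : List (StackLetter X α)} {u v : List X}
    (h : StackLetter.PopsPushes l u v) {z y : List X} :
    Acts (value l) z y ↔ ∃ w, z = w ++ u.reverse ∧ y = w ++ v := by
  induction h generalizing z y with
  | pushes h => simp [acts_value_pushes h]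
  | pop x hd _ ih =>
    simp only [value_append, value_cons, value_dyck hd, letterValue, acts_mul, acts_pop, ih,
      one_mul]
    constructor
    · rintro ⟨k, rfl, w, rfl, rfl⟩
      exact ⟨w, by simp, rfl⟩
    · rintro ⟨w, rfl, rfl⟩
      exact ⟨_, by simp, w, rfl, rfl⟩

/-- At the mismatched pop the top of the stack is the wrong letter whatever the initial stack was,
so the value is the empty map. -/
theorem not_acts_value_mismatch {l : List (StackLetter X α)} (h : StackLetter.Mismatch l)
    {z y : List X} : ¬ Acts (value l) z y := by
  induction h generalizing z y with
  | mismatch hxy hd l =>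
    simp only [value_append, value_cons, value_dyck hd, letterValue, acts_mul, acts_push, acts_pop,
      one_mul]
    rintro ⟨k, rfl, k', h, -⟩
    exact hxy (by simpa using (List.append_inj' h rfl).2)
  | cons a _ ih =>
    rw [value_cons, acts_mul]
    rintro ⟨k, -, h⟩
    exact ih h

/-- The normal form is recovered from the action: `u.reverse` is the shortest stack in the domain,
and its image is `v`. -/
theorem value_eq_value_iff {β : Type*} {l : List (StackLetter X α)}
    {l' : List (StackLetter X β)} : value l = value l' ↔
      (StackLetter.Mismatch l ∧ StackLetter.Mismatch l') ∨
        ∃ u v, StackLetter.PopsPushes l u v ∧ StackLetter.PopsPushes l' u v := by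
  constructor
  · intro h
    have key (z y) : Acts (value l) z y ↔ Acts (value l') z y := by rw [h]
    obtain hl | ⟨u, v, hl⟩ := StackLetter.mismatch_or_popsPushes l <;>
      obtain hl' | ⟨u', v', hl'⟩ := StackLetter.mismatch_or_popsPushes l'
    · exact .inl ⟨hl, hl'⟩
    · exact (not_acts_value_mismatch hl
        ((key _ _).2 ((acts_value_popsPushes hl').2 ⟨[], rfl, rfl⟩))).elim
    · exact (not_acts_value_mismatch hl'
        ((key _ _).1 ((acts_value_popsPushes hl).2 ⟨[], rfl, rfl⟩))).elim
    · obtain ⟨w, hu, hv⟩ := (acts_value_popsPushes hl').1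
        ((key _ _).1 ((acts_value_popsPushes hl).2 ⟨[], rfl, rfl⟩))
      obtain ⟨w', hu', -⟩ := (acts_value_popsPushes hl).1
        ((key _ _).2 ((acts_value_popsPushes hl').2 ⟨[], rfl, rfl⟩))
      have h1 := congrArg List.length hu
      have h2 := congrArg List.length hu'
      simp only [List.nil_append, List.length_append] at h1 h2
      -- Each of the two minimal stacks is a suffix of the other, so they have equal length.
      have hw : w = [] := List.eq_nil_of_length_eq_zero (by omega)
      subst hw
      simp only [List.nil_append, List.reverse_inj] at hu hv
      subst hu hv
      exact .inr ⟨_, _, hl, hl'⟩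
  · rintro (⟨hl, hl'⟩ | ⟨u, v, hl, hl'⟩)
    · exact ext_acts fun z y =>
        iff_of_false (not_acts_value_mismatch hl) (not_acts_value_mismatch hl')
    · exact ext_acts fun z y => by rw [acts_value_popsPushes hl, acts_value_popsPushes hl']

theorem exists_value_eq (m : PolycyclicMonoid X) :
    ∃ l : List (StackLetter X α), value l = m ∧ StackLetter.inputWord l = [] := by
  obtain ⟨m, hm⟩ := m
  induction hm using Submonoid.closure_induction with
  | mem m hm =>
    obtain ⟨x, rfl⟩ | ⟨x, rfl⟩ := hm
    · exact ⟨[.push x], by simp [value, letterValue, push], by simp⟩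
    · exact ⟨[.pop x], by simp [value, letterValue, pop], by simp⟩
  | one => exact ⟨[], rfl, rfl⟩
  | mul m n hm hn ihm ihn =>
    obtain ⟨l, hl, hlw⟩ := ihm
    obtain ⟨l', hl', hlw'⟩ := ihn
    exact ⟨l ++ l', by rw [value_append, hl, hl']; rfl, by simp [hlw, hlw']⟩

end PolycyclicMonoid

/-! ### Spelling out edge labels. -/

namespace FiniteAutomaton

/-- `Reaches step s l t`: the word `l` leads from `s` to `t` in the labelled transition system
`step`. -/
def Reaches {Λ S : Type*} (step : S → Λ → S → Prop) : S → List Λ → S → Prop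
  | s, [], t => s = t
  | s, a :: l, t => ∃ r, step s a r ∧ Reaches step r l t

section Reaches

variable {Λ S : Type*} {step : S → Λ → S → Prop}

@[simp] theorem reaches_nil {s t : S} : Reaches step s [] t ↔ s = t := Iff.rfl

@[simp] theorem reaches_cons {s t : S} {a : Λ} {l : List Λ} :
    Reaches step s (a :: l) t ↔ ∃ r, step s a r ∧ Reaches step r l t := Iff.rfl

@[simp] theorem reaches_append {s t : S} {l l' : List Λ} :
    Reaches step s (l ++ l') t ↔ ∃ r, Reaches step s l r ∧ Reaches step r l' t := by
  induction l generalizing s with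
  | nil => simp
  | cons a l ih =>
    simp only [List.cons_append, reaches_cons, ih]
    exact ⟨fun ⟨r, h, q, h', h''⟩ => ⟨q, ⟨r, h, h'⟩, h''⟩,
      fun ⟨q, ⟨r, h, h'⟩, h''⟩ => ⟨r, h, q, h', h''⟩⟩

end Reaches

theorem HasPath.trans {M : Type*} [Monoid M] {A : FiniteAutomaton M} {u v w : A.V} {m n : M}
    (h : A.HasPath u m v) (h' : A.HasPath v n w) : A.HasPath u (m * n) w := by
  induction h with
  | nil u => simpa using h'
  | cons he _ ih => simpa [mul_assoc] using HasPath.cons he (ih h')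

/-- Edge labels can be spelled out in letters, at the cost of intermediate vertices. -/
theorem exists_reaches.{u, v} {M : Type u} {Λ : Type v} [Monoid M] (A : FiniteAutomaton M)
    (f : Λ → M)
    (hf : ∀ m, ∃ l : List Λ, l ≠ [] ∧ (l.map f).prod = m) :
    ∃ (S : Type v) (_ : Finite S) (step : S → Λ → S → Prop) (i : S) (T : Set S),
      ∀ m, m ∈ A.accepted ↔ ∃ t ∈ T, ∃ l, Reaches step i l t ∧ (l.map f).prod = m := by
  classical
  have := A.finite_V
  choose c hc0 hc using hf
  -- A state is the still unread part of an edge label together with the vertex where that edge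
  -- ends. Only suffixes of the finitely many labels occur.
  set F : Set (List Λ × A.V) :=
    {p | p.1 ∈ ({[]} ∪ ⋃ e ∈ A.edges, {l | l <:+ c e.2.1} : Set (List Λ))} with hF
  have hfin : F.Finite := by
    have h1 : ({[]} ∪ ⋃ e ∈ A.edges, {l | l <:+ c e.2.1} : Set (List Λ)).Finite := by
      refine (Set.finite_singleton _).union (A.edges.finite_toSet.biUnion fun e _ => ?_)
      refine ((c e.2.1).tails.toFinset.finite_toSet).subset fun l hl => ?_
      simpa using hl
    exact (h1.prod Set.finite_univ).subset fun p hp => ⟨hp, trivial⟩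
  have hnil (v : A.V) : (([], v) : List Λ × A.V) ∈ F := .inl rfl
  have hcons {a : Λ} {l : List Λ} {v : A.V} (h : ((a :: l, v) : List Λ × A.V) ∈ F) :
      ((l, v) : List Λ × A.V) ∈ F := by
    obtain h | h := h
    · simp at h
    · right
      simp only [Set.mem_iUnion, Set.mem_ofPred_eq] at h ⊢
      obtain ⟨e, he, h⟩ := h
      exact ⟨e, he, (List.suffix_cons a l).trans h⟩
  have hedge {u v : A.V} {m : M} (he : (u, m, v) ∈ A.edges) :
      ((c m, v) : List Λ × A.V) ∈ F := by
    right
    simp only [Set.mem_iUnion, Set.mem_ofPred_eq]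
    exact ⟨_, he, List.suffix_rfl⟩
  -- Either the next pending letter is read, or nothing is pending and an edge is entered by reading
  -- the first letter of its spelling. This is why spellings must be nonempty: there are no silent
  -- moves.
  let step (p : F) (a : Λ) (q : F) : Prop :=
    p.1.1 = a :: q.1.1 ∧ p.1.2 = q.1.2 ∨
      p.1.1 = [] ∧ ∃ m, (p.1.2, m, q.1.2) ∈ A.edges ∧ c m = a :: q.1.1
  have hspell (l : List Λ) (v : A.V) (h : ((l, v) : List Λ × A.V) ∈ F) :
      Reaches step ⟨(l, v), h⟩ l ⟨([], v), hnil v⟩ := by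
    induction l with
    | nil => rfl
    | cons a l ih => exact ⟨⟨(l, v), hcons h⟩, .inl ⟨rfl, rfl⟩, ih _⟩
  have hpath {u v : A.V} {m : M} (h : A.HasPath u m v) :
      ∃ l, Reaches step ⟨([], u), hnil u⟩ l ⟨([], v), hnil v⟩ ∧ (l.map f).prod = m := by
    induction h with
    | nil u => exact ⟨[], rfl, rfl⟩
    | @cons u v w m n he _ ih =>
      obtain ⟨l, hl, rfl⟩ := ih
      refine ⟨c m ++ l, reaches_append.2 ⟨_, ?_, hl⟩, by simp [hc]⟩
      have hm := hedge he
      cases hcm : c m with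
      | nil => exact (hc0 m hcm).elim
      | cons a k =>
        rw [hcm] at hm
        exact ⟨⟨(k, v), hcons hm⟩, .inr ⟨rfl, m, he, hcm⟩, hspell _ _ _⟩
  -- Generalised to runs that start in the middle of an edge, which must first finish the pending
  -- letters.
  have hreach (l : List Λ) (p : F) (t : A.V) (h : Reaches step p l ⟨([], t), hnil t⟩) :
      ∃ l', l = p.1.1 ++ l' ∧ A.HasPath p.1.2 (l'.map f).prod t := by
    induction l generalizing p with
    | nil =>
      obtain rfl : p = _ := h
      exact ⟨[], rfl, .nil _⟩
    | cons a l ih =>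
      obtain ⟨q, hpq, hq⟩ := h
      obtain ⟨l', rfl, hl'⟩ := ih q hq
      obtain ⟨h1, h2⟩ | ⟨h1, m, hm, hcm⟩ := hpq
      · exact ⟨l', by simp [h1], h2 ▸ hl'⟩
      · refine ⟨a :: (q.1.1 ++ l'), by simp [h1], ?_⟩
        rw [← List.cons_append, ← hcm, List.map_append, List.prod_append, hc]
        exact .cons hm hl'
  refine ⟨F, hfin.to_subtype, step, ⟨([], A.init), hnil _⟩, {p | ∃ t ∈ A.terminal, p.1 = ([], t)},
    fun m => ⟨?_, ?_⟩⟩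
  · rintro ⟨t, ht, h⟩
    exact ⟨_, ⟨t, ht, rfl⟩, hpath h⟩
  · rintro ⟨⟨_, _⟩, ⟨t, ht, rfl⟩, l, hl, rfl⟩
    obtain ⟨l', rfl, h⟩ := hreach _ _ _ hl
    exact ⟨t, ht, h⟩

end FiniteAutomaton

/-! ### Derivation trees of context-free grammars. -/

/-- `DerivesWord rule s w`: the sentential form `s` can be rewritten to the word `w`, where
`rule A u` says that the nonterminal `A` may be replaced by `u`. -/
inductive DerivesWord {α N : Type*} (rule : N → List (Symbol α N) → Prop) :
    List (Symbol α N) → List α → Prop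
  | nil : DerivesWord rule [] []
  | terminal (a : α) {s : List (Symbol α N)} {w : List α} (h : DerivesWord rule s w) :
      DerivesWord rule (.terminal a :: s) (a :: w)
  | nonterminal {A : N} {u s : List (Symbol α N)} {v w : List α} (hr : rule A u)
      (hu : DerivesWord rule u v) (h : DerivesWord rule s w) :
      DerivesWord rule (.nonterminal A :: s) (v ++ w)

namespace DerivesWord

variable {α N : Type*} {rule : N → List (Symbol α N) → Prop}

theorem append {s t : List (Symbol α N)} {v w : List α} (hs : DerivesWord rule s v)
    (ht : DerivesWord rule t w) : DerivesWord rule (s ++ t) (v ++ w) := by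
  induction hs with
  | nil => exact ht
  | terminal a _ ih => exact ih.terminal a
  | nonterminal hr hu _ _ ih => simpa using nonterminal hr hu ih

theorem exists_of_append {s t : List (Symbol α N)} {w : List α}
    (h : DerivesWord rule (s ++ t) w) :
    ∃ w₁ w₂, w = w₁ ++ w₂ ∧ DerivesWord rule s w₁ ∧ DerivesWord rule t w₂ := by
  induction s generalizing w with
  | nil => exact ⟨[], w, rfl, nil, h⟩
  | cons X s ih =>
    cases h with
    | terminal a h =>
      obtain ⟨w₁, w₂, rfl, h₁, h₂⟩ := ih h
      exact ⟨a :: w₁, w₂, rfl, h₁.terminal a, h₂⟩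
    | @nonterminal A u _ v _ hr hu h =>
      obtain ⟨w₁, w₂, rfl, h₁, h₂⟩ := ih h
      exact ⟨v ++ w₁, w₂, by simp, nonterminal hr hu h₁, h₂⟩

theorem map_terminal (w : List α) : DerivesWord rule (w.map .terminal) w := by
  induction w with
  | nil => exact nil
  | cons a w ih => exact ih.terminal a

theorem rewrite {A : N} {u : List (Symbol α N)} {w : List α} (hr : rule A u)
    (hu : DerivesWord rule u w) : DerivesWord rule [.nonterminal A] w := by
  simpa using nonterminal hr hu nil

end DerivesWord

/-- This replaces rewriting sequences by derivation trees, on which induction is possible. A first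
rewriting step is absorbed by cutting the tree of the result at the ends of the inserted right-hand
side. -/
theorem ContextFreeGrammar.derives_map_terminal_iff {α : Type*} (g : ContextFreeGrammar α)
    {s : List (Symbol α g.NT)} {w : List α} :
    g.Derives s (w.map .terminal) ↔ DerivesWord (fun A u => ⟨A, u⟩ ∈ g.rules) s w := by
  constructor
  · intro h
    generalize hz : w.map Symbol.terminal = z at h
    induction h using Relation.ReflTransGen.head_induction_on with
    | refl => exact hz ▸ .map_terminal w
    | head hp _ ih =>
      obtain ⟨r, hr, hrw⟩ := hp
      obtain ⟨p, q, rfl, rfl⟩ := hrw.exists_parts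
      obtain ⟨_, w₃, rfl, h, h₃⟩ := DerivesWord.exists_of_append ih
      obtain ⟨w₁, w₂, rfl, h₁, h₂⟩ := DerivesWord.exists_of_append h
      exact (h₁.append (.rewrite hr h₂)).append h₃
  · intro h
    induction h with
    | nil => rfl
    | terminal a _ ih => simpa using ih.append_left [.terminal a]
    | @nonterminal A u s v w hr hu h ihu ih =>
      have h1 : g.Produces (.nonterminal A :: s) (u ++ s) := ⟨_, hr, .head s⟩
      rw [List.map_append]
      exact (h1.trans_derives (ihu.append_right s)).trans (ih.append_left _)

namespace DerivesWord

variable {α N : Type*}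

/-- A grammar with finitely many nonterminals and bounded right-hand sides over a finite alphabet
generates a context-free language. -/
theorem isContextFree [Finite α] [Finite N] {rule : N → List (Symbol α N) → Prop} (k : ℕ)
    (hk : ∀ A u, rule A u → u.length ≤ k) (A : N) :
    Language.IsContextFree ({w | DerivesWord rule [.nonterminal A] w} : Language α) := by
  -- Renaming the nonterminals by `Fin n` moves them from an arbitrary universe to `Type`.
  obtain ⟨n, ⟨e⟩⟩ := Finite.exists_equiv_fin N
  let f : Symbol α N → Symbol α (Fin n) := fun X => match X with
    | .terminal a => .terminal a
    | .nonterminal B => .nonterminal (e B)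
  have hf : Function.Injective f := by
    rintro (a | B) (b | C) h <;> simp_all [f]
  have hS : Finite (Symbol α N) := by
    refine Finite.of_injective (β := α ⊕ N)
      (fun X => match X with | .terminal a => .inl a | .nonterminal B => .inr B) ?_
    rintro (a | B) (b | C) h <;> simp_all
  have hfin : {r : ContextFreeRule α (Fin n) |
      ∃ B u, rule B u ∧ r = ⟨e B, u.map f⟩}.Finite := by
    refine ((Set.finite_univ (α := N)).prod (List.finite_length_le (Symbol α N) k)).image
      (fun p : N × List (Symbol α N) => (⟨e p.1, p.2.map f⟩ : ContextFreeRule α (Fin n)))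
      |>.subset ?_
    rintro r ⟨B, u, hr, rfl⟩
    exact ⟨(B, u), ⟨trivial, hk B u hr⟩, rfl⟩
  refine ⟨⟨Fin n, e A, hfin.toFinset⟩, ?_⟩
  ext w
  rw [ContextFreeGrammar.mem_language_iff, ContextFreeGrammar.derives_map_terminal_iff]
  change _ ↔ DerivesWord rule [.nonterminal A] w
  have key (s : List (Symbol α N)) (w : List α) : DerivesWord (fun B u =>
      (⟨B, u⟩ : ContextFreeRule α (Fin n)) ∈ hfin.toFinset) (s.map f) w ↔
        DerivesWord rule s w := by
    constructor
    · intro h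
      generalize hz : s.map f = z at h
      induction h generalizing s with
      | nil =>
        obtain rfl := List.map_eq_nil_iff.1 hz
        exact nil
      | terminal a _ ih =>
        obtain ⟨X, s, rfl, hX, rfl⟩ := List.map_eq_cons_iff.1 hz
        obtain rfl : X = .terminal a := hf hX
        exact (ih s rfl).terminal a
      | nonterminal hr' _ _ ihu ih =>
        obtain ⟨X, s, rfl, hX, rfl⟩ := List.map_eq_cons_iff.1 hz
        obtain ⟨B, u, hr, h⟩ := hfin.mem_toFinset.1 hr'
        simp only [ContextFreeRule.mk.injEq] at h
        obtain ⟨rfl, rfl⟩ := h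
        obtain rfl : X = .nonterminal B := hf hX
        exact nonterminal hr (ihu u rfl) (ih s rfl)
    · intro h
      induction h with
      | nil => exact nil
      | terminal a _ ih => exact ih.terminal a
      | nonterminal hr _ _ ihu ih =>
        exact nonterminal (hfin.mem_toFinset.2 ⟨_, _, hr, rfl⟩) ihu ih
  exact key [.nonterminal A] w

/-- The words obtained from a sentential form by filling in a language for each nonterminal. -/
def Fills (L : N → List α → Prop) : List (Symbol α N) → List α → Prop
  | [], w => w = []
  | .terminal a :: s, w => ∃ v, w = a :: v ∧ Fills L s v
  | .nonterminal A :: s, w => ∃ u v, w = u ++ v ∧ L A u ∧ Fills L s v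

theorem fills {rule : N → List (Symbol α N) → Prop} {L : N → List α → Prop}
    (hL : ∀ A u, rule A u → ∀ w, Fills L u w → L A w) {s : List (Symbol α N)} {w : List α}
    (h : DerivesWord rule s w) : Fills L s w := by
  induction h with
  | nil => rfl
  | terminal a _ ih => exact ⟨_, rfl, ih⟩
  | nonterminal hr _ _ ihu ih => exact ⟨_, _, rfl, hL _ _ hr _ ihu, ih⟩

/-- The generated languages form the least family closed under the rules, so soundness of a grammar
can be checked rule by rule. -/
theorem of_rewrite {rule : N → List (Symbol α N) → Prop} {L : N → List α → Prop}
    (hL : ∀ A u, rule A u → ∀ w, Fills L u w → L A w) {A : N} {w : List α}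
    (h : DerivesWord rule [.nonterminal A] w) : L A w := by
  obtain ⟨u, v, rfl, hu, rfl⟩ := h.fills hL
  simpa using hu

end DerivesWord

/-! ### The grammar comparing two stack automata. -/

namespace StackLetter

open FiniteAutomaton

/-- The nonterminals of the grammar that compares two stack automata. -/
inductive CompareNT (S S' : Type*)
  | start
  | dyck (s t : S)
  | pops (s : S) (s' : S')
  | pushes (s : S) (s' : S')
  | mismatch (s : S)
  | rest (s : S)

theorem CompareNT.finite (S S' : Type*) [Finite S] [Finite S'] : Finite (CompareNT S S') := by
  let f : CompareNT S S' → Unit ⊕ (S × S) ⊕ (S × S') ⊕ (S × S') ⊕ S ⊕ S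
    | .start => .inl ()
    | .dyck s t => .inr (.inl (s, t))
    | .pops s s' => .inr (.inr (.inl (s, s')))
    | .pushes s s' => .inr (.inr (.inr (.inl (s, s'))))
    | .mismatch s => .inr (.inr (.inr (.inr (.inl s))))
    | .rest s => .inr (.inr (.inr (.inr (.inr s))))
  refine Finite.of_injective f ?_
  rintro (_ | _) (_ | _) h <;> simp_all [f]

section Compare

variable {X α S S' : Type*}

/-- Some Dyck word leads from `s` to `t`. -/
def DyckReaches (step : S → StackLetter X α → S → Prop) (s t : S) : Prop :=
  ∃ l, Dyck l ∧ Reaches step s l t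

/-- The rules of the grammar that compares two stack automata. -/
inductive CompareRule (A : S → StackLetter X α → S → Prop) (B : S' → StackLetter X α → S' → Prop)
    (i : S) (i' : S') (T : Set S) (T' : Set S') (zero : Prop) :
    CompareNT S S' → List (Symbol α (CompareNT S S')) → Prop
  | start_pops : CompareRule A B i i' T T' zero .start [.nonterminal (.pops i i')]
  | start_mismatch (h : zero) : CompareRule A B i i' T T' zero .start [.nonterminal (.mismatch i)]
  | dyck_nil (s : S) : CompareRule A B i i' T T' zero (.dyck s s) []
  | dyck_read {s r : S} {a : α} (t : S) (h : A s (read a) r) :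
      CompareRule A B i i' T T' zero (.dyck s t) [.terminal a, .nonterminal (.dyck r t)]
  | dyck_push {s s₁ s₂ s₃ : S} {x : X} (t : S) (h : A s (push x) s₁) (h' : A s₂ (pop x) s₃) :
      CompareRule A B i i' T T' zero (.dyck s t)
        [.nonterminal (.dyck s₁ s₂), .nonterminal (.dyck s₃ t)]
  | pops_pushes (s : S) (s' : S') :
      CompareRule A B i i' T T' zero (.pops s s') [.nonterminal (.pushes s s')]
  -- Both automata pop the same letter `x`. The Dyck segment of the first yields output; that of the
  -- second is only required to exist.
  | pops_pop {s r t : S} {s' r' t' : S'} {x : X} (h : A r (pop x) t)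
      (hd : DyckReaches B s' r') (h' : B r' (pop x) t') :
      CompareRule A B i i' T T' zero (.pops s s')
        [.nonterminal (.dyck s r), .nonterminal (.pops t t')]
  | pushes_dyck {s t : S} {s' t' : S'} (h : t ∈ T) (hd : DyckReaches B s' t') (h' : t' ∈ T') :
      CompareRule A B i i' T T' zero (.pushes s s') [.nonterminal (.dyck s t)]
  | pushes_push {s r t : S} {s' r' t' : S'} {x : X} (h : A r (push x) t)
      (hd : DyckReaches B s' r') (h' : B r' (push x) t') :
      CompareRule A B i i' T T' zero (.pushes s s')
        [.nonterminal (.dyck s r), .nonterminal (.pushes t t')]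
  | mismatch_cons {s t : S} {b : StackLetter X α} (h : A s b t) :
      CompareRule A B i i' T T' zero (.mismatch s)
        ((inputWord [b]).map .terminal ++ [.nonterminal (.mismatch t)])
  -- After a mismatch the value is zero for good, so the remaining run is unconstrained.
  | mismatch_push {s s₁ s₂ s₃ : S} {x y : X} (hxy : x ≠ y) (h : A s (push x) s₁)
      (h' : A s₂ (pop y) s₃) :
      CompareRule A B i i' T T' zero (.mismatch s)
        [.nonterminal (.dyck s₁ s₂), .nonterminal (.rest s₃)]
  | rest_nil {s : S} (h : s ∈ T) : CompareRule A B i i' T T' zero (.rest s) []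
  | rest_cons {s t : S} {b : StackLetter X α} (h : A s b t) :
      CompareRule A B i i' T T' zero (.rest s)
        ((inputWord [b]).map .terminal ++ [.nonterminal (.rest t)])

/-- The languages of the nonterminals. -/
def CompareLanguage (A : S → StackLetter X α → S → Prop) (B : S' → StackLetter X α → S' → Prop)
    (i : S) (i' : S') (T : Set S) (T' : Set S') (zero : Prop) : CompareNT S S' → List α → Prop
  | .start, w => ∃ l, inputWord l = w ∧ (∃ t ∈ T, Reaches A i l t) ∧
      (zero ∧ Mismatch l ∨ ∃ u v l', PopsPushes l u v ∧ PopsPushes l' u v ∧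
        ∃ t' ∈ T', Reaches B i' l' t')
  | .dyck s t, w => ∃ l, inputWord l = w ∧ Dyck l ∧ Reaches A s l t
  | .pops s s', w => ∃ l, inputWord l = w ∧ (∃ t ∈ T, Reaches A s l t) ∧
      ∃ u v l', PopsPushes l u v ∧ PopsPushes l' u v ∧ ∃ t' ∈ T', Reaches B s' l' t'
  | .pushes s s', w => ∃ l, inputWord l = w ∧ (∃ t ∈ T, Reaches A s l t) ∧
      ∃ v l', Pushes l v ∧ Pushes l' v ∧ ∃ t' ∈ T', Reaches B s' l' t'
  | .mismatch s, w => ∃ l, inputWord l = w ∧ (∃ t ∈ T, Reaches A s l t) ∧ Mismatch l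
  | .rest s, w => ∃ l, inputWord l = w ∧ ∃ t ∈ T, Reaches A s l t

variable {A : S → StackLetter X α → S → Prop} {B : S' → StackLetter X α → S' → Prop}
  {i : S} {i' : S'} {T : Set S} {T' : Set S'} {zero : Prop}

theorem CompareRule.length_le {n : CompareNT S S'} {u : List (Symbol α (CompareNT S S'))}
    (h : CompareRule A B i i' T T' zero n u) : u.length ≤ 2 := by
  cases h with
  | @mismatch_cons _ _ b h => cases b <;> simp
  | @rest_cons _ _ b h => cases b <;> simp
  | _ => simp

theorem fills_append_nonterminal {N : Type*} {L : N → List α → Prop} {v w : List α} {n : N} :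
    DerivesWord.Fills L (v.map .terminal ++ [.nonterminal n]) w ↔ ∃ u, w = v ++ u ∧ L n u := by
  induction v generalizing w with
  | nil => simp [DerivesWord.Fills]
  | cons a v ih =>
    simp only [List.map_cons, List.cons_append, DerivesWord.Fills, ih]
    exact ⟨fun ⟨_, h, u, h', h''⟩ => ⟨u, h' ▸ h, h''⟩, fun ⟨u, h, h'⟩ => ⟨_, h, u, rfl, h'⟩⟩

theorem inputWord_cons (b : StackLetter X α) (l : List (StackLetter X α)) :
    inputWord (b :: l) = inputWord [b] ++ inputWord l :=
  inputWord_append [b] l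

theorem CompareRule.sound {n : CompareNT S S'} {u : List (Symbol α (CompareNT S S'))}
    (h : CompareRule A B i i' T T' zero n u) (w : List α)
    (hw : DerivesWord.Fills (CompareLanguage A B i i' T T' zero) u w) :
    CompareLanguage A B i i' T T' zero n w := by
  cases h with
  | start_pops =>
    obtain ⟨_, _, rfl, ⟨l, rfl, h, h'⟩, rfl⟩ := hw
    exact ⟨l, by simp, h, .inr h'⟩
  | start_mismatch hz =>
    obtain ⟨_, _, rfl, ⟨l, rfl, h, h'⟩, rfl⟩ := hw
    exact ⟨l, by simp, h, .inl ⟨hz, h'⟩⟩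
  | dyck_nil s =>
    obtain rfl := hw
    exact ⟨[], rfl, .nil, rfl⟩
  | dyck_read t h =>
    obtain ⟨_, rfl, _, _, rfl, ⟨l, rfl, hd, hl⟩, rfl⟩ := hw
    exact ⟨_, by simp, hd.read _, _, h, hl⟩
  | dyck_push t h h' =>
    obtain ⟨_, _, rfl, ⟨l, rfl, hd, hl⟩, _, _, rfl, ⟨k, rfl, hd', hk⟩, rfl⟩ := hw
    exact ⟨_, by simp, .push _ hd hd', _, h, reaches_append.2 ⟨_, hl, _, h', hk⟩⟩
  | pops_pushes s s' =>
    obtain ⟨_, _, rfl, ⟨l, rfl, h, v, l', hl, hl', h'⟩, rfl⟩ := hw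
    exact ⟨l, by simp, h, [], v, l', .pushes hl, .pushes hl', h'⟩
  | pops_pop h hd h' =>
    obtain ⟨_, _, rfl, ⟨d, rfl, hd₁, hs⟩, _, _, rfl,
      ⟨l, rfl, ⟨t, ht, hr⟩, u, v, l', hl, hl', t', ht', hr'⟩, rfl⟩ := hw
    obtain ⟨d', hd', hs'⟩ := hd
    exact ⟨_, by simp, ⟨t, ht, reaches_append.2 ⟨_, hs, reaches_cons.2 ⟨_, h, hr⟩⟩⟩,
      _, v, _, .pop _ hd₁ hl,
      .pop _ hd' hl', t', ht', reaches_append.2 ⟨_, hs', reaches_cons.2 ⟨_, h', hr'⟩⟩⟩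
  | pushes_dyck h hd h' =>
    obtain ⟨_, _, rfl, ⟨d, rfl, hd₁, hs⟩, rfl⟩ := hw
    obtain ⟨d', hd', hs'⟩ := hd
    exact ⟨d, by simp, ⟨_, h, hs⟩, [], d', .dyck hd₁, .dyck hd', _, h', hs'⟩
  | pushes_push h hd h' =>
    obtain ⟨_, _, rfl, ⟨d, rfl, hd₁, hs⟩, _, _, rfl,
      ⟨l, rfl, ⟨t, ht, hr⟩, v, l', hl, hl', t', ht', hr'⟩, rfl⟩ := hw
    obtain ⟨d', hd', hs'⟩ := hd
    exact ⟨_, by simp, ⟨t, ht, reaches_append.2 ⟨_, hs, reaches_cons.2 ⟨_, h, hr⟩⟩⟩,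
      _, _, .push _ hd₁ hl,
      .push _ hd' hl', t', ht', reaches_append.2 ⟨_, hs', reaches_cons.2 ⟨_, h', hr'⟩⟩⟩
  | mismatch_cons h =>
    obtain ⟨_, rfl, l, rfl, ⟨t, ht, hr⟩, hl⟩ := fills_append_nonterminal.1 hw
    exact ⟨_, inputWord_cons _ l, ⟨t, ht, _, h, hr⟩, hl.cons _⟩
  | mismatch_push hxy h h' =>
    obtain ⟨_, _, rfl, ⟨d, rfl, hd, hs⟩, _, _, rfl, ⟨l, rfl, t, ht, hr⟩, rfl⟩ := hw
    exact ⟨_, by simp,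
      ⟨t, ht, reaches_cons.2 ⟨_, h, reaches_append.2 ⟨_, hs, reaches_cons.2 ⟨_, h', hr⟩⟩⟩⟩,
      .mismatch hxy hd l⟩
  | rest_nil h =>
    obtain rfl := hw
    exact ⟨[], rfl, _, h, rfl⟩
  | rest_cons h =>
    obtain ⟨_, rfl, l, rfl, t, ht, hr⟩ := fills_append_nonterminal.1 hw
    exact ⟨_, inputWord_cons _ l, t, ht, _, h, hr⟩

/-- Each nonterminal is treated by induction on the stack structure of the first word. For `pops`
and `pushes` the second word is decomposed in parallel, which works because both words share `u` and
`v`. -/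
theorem CompareRule.derivesWord {n : CompareNT S S'} {w : List α}
    (h : CompareLanguage A B i i' T T' zero n w) :
    DerivesWord (CompareRule A B i i' T T' zero) [.nonterminal n] w := by
  have two {n m : CompareNT S S'} {v w : List α}
      (hv : DerivesWord (CompareRule A B i i' T T' zero) [.nonterminal n] v)
      (hw : DerivesWord (CompareRule A B i i' T T' zero) [.nonterminal m] w) :
      DerivesWord (CompareRule A B i i' T T' zero) [.nonterminal n, .nonterminal m] (v ++ w) :=
    hv.append hw
  have hdyck {s t : S} {l : List (StackLetter X α)} (hl : Dyck l) (hr : Reaches A s l t) :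
      DerivesWord (CompareRule A B i i' T T' zero) [.nonterminal (.dyck s t)] (inputWord l) := by
    induction hl generalizing s t with
    | nil =>
      obtain rfl := hr
      exact .rewrite (.dyck_nil s) .nil
    | read a _ ih =>
      obtain ⟨r, h, hr⟩ := hr
      simpa using DerivesWord.rewrite (.dyck_read t h) ((ih hr).terminal a)
    | push x _ _ ihd ih =>
      obtain ⟨s₁, h, hr⟩ := hr
      obtain ⟨s₂, hd, s₃, h', hr⟩ := reaches_append.1 hr
      simpa using DerivesWord.rewrite (.dyck_push t h h') (two (ihd hd) (ih hr))
  have hrest {s t : S} {l : List (StackLetter X α)} (ht : t ∈ T) (hr : Reaches A s l t) :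
      DerivesWord (CompareRule A B i i' T T' zero) [.nonterminal (.rest s)] (inputWord l) := by
    induction l generalizing s with
    | nil =>
      obtain rfl := hr
      exact .rewrite (.rest_nil ht) .nil
    | cons b l ih =>
      obtain ⟨r, h, hr⟩ := hr
      rw [inputWord_cons]
      exact .rewrite (.rest_cons h) ((DerivesWord.map_terminal _).append (ih hr))
  have hmis {s t : S} {l : List (StackLetter X α)} (hl : Mismatch l) (ht : t ∈ T)
      (hr : Reaches A s l t) :
      DerivesWord (CompareRule A B i i' T T' zero) [.nonterminal (.mismatch s)]
        (inputWord l) := by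
    induction hl generalizing s with
    | mismatch hxy hd l =>
      obtain ⟨s₁, h, hr⟩ := hr
      obtain ⟨s₂, hs, s₃, h', hr⟩ := reaches_append.1 hr
      simpa using DerivesWord.rewrite (.mismatch_push hxy h h') (two (hdyck hd hs) (hrest ht hr))
    | cons b _ ih =>
      obtain ⟨r, h, hr⟩ := hr
      rw [inputWord_cons]
      exact .rewrite (.mismatch_cons h) ((DerivesWord.map_terminal _).append (ih hr))
  have hpushes {s t : S} {s' t' : S'} {l l' : List (StackLetter X α)} {v : List X}
      (hl : Pushes l v) (hl' : Pushes l' v) (ht : t ∈ T) (hr : Reaches A s l t) (ht' : t' ∈ T')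
      (hr' : Reaches B s' l' t') :
      DerivesWord (CompareRule A B i i' T T' zero) [.nonterminal (.pushes s s')]
        (inputWord l) := by
    induction hl generalizing s s' l' with
    | dyck hd =>
      cases hl' with
      | dyck hd' => exact .rewrite (.pushes_dyck ht ⟨_, hd', hr'⟩ ht') (hdyck hd hr)
    | push x hd _ ih =>
      cases hl' with
      | push _ hd' hl' =>
        obtain ⟨s₁, hs, s₂, h, hr⟩ := reaches_append.1 hr
        obtain ⟨s₁', hs', s₂', h', hr'⟩ := reaches_append.1 hr'
        simpa using DerivesWord.rewrite (.pushes_push h ⟨_, hd', hs'⟩ h')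
          (two (hdyck hd hs) (ih hl' hr hr'))
  have hpops {s t : S} {s' t' : S'} {l l' : List (StackLetter X α)} {u v : List X}
      (hl : PopsPushes l u v) (hl' : PopsPushes l' u v) (ht : t ∈ T) (hr : Reaches A s l t)
      (ht' : t' ∈ T') (hr' : Reaches B s' l' t') :
      DerivesWord (CompareRule A B i i' T T' zero) [.nonterminal (.pops s s')]
        (inputWord l) := by
    induction hl generalizing s s' l' with
    | pushes hl =>
      cases hl' with
      | pushes hl' => exact .rewrite (.pops_pushes s s') (hpushes hl hl' ht hr ht' hr')
    | pop x hd _ ih =>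
      cases hl' with
      | pop _ hd' hl' =>
        obtain ⟨s₁, hs, s₂, h, hr⟩ := reaches_append.1 hr
        obtain ⟨s₁', hs', s₂', h', hr'⟩ := reaches_append.1 hr'
        simpa using DerivesWord.rewrite (.pops_pop h ⟨_, hd', hs'⟩ h')
          (two (hdyck hd hs) (ih hl' hr hr'))
  cases n with
  | start =>
    obtain ⟨l, rfl, ⟨t, ht, hr⟩, ⟨hz, hl⟩ | ⟨u, v, l', hl, hl', t', ht', hr'⟩⟩ := h
    · exact .rewrite (.start_mismatch hz) (hmis hl ht hr)
    · exact .rewrite .start_pops (hpops hl hl' ht hr ht' hr')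
  | dyck s t =>
    obtain ⟨l, rfl, hl, hr⟩ := h
    exact hdyck hl hr
  | pops s s' =>
    obtain ⟨l, rfl, ⟨t, ht, hr⟩, u, v, l', hl, hl', t', ht', hr'⟩ := h
    exact hpops hl hl' ht hr ht' hr'
  | pushes s s' =>
    obtain ⟨l, rfl, ⟨t, ht, hr⟩, v, l', hl, hl', t', ht', hr'⟩ := h
    exact hpushes hl hl' ht hr ht' hr'
  | mismatch s =>
    obtain ⟨l, rfl, ⟨t, ht, hr⟩, hl⟩ := h
    exact hmis hl ht hr
  | rest s =>
    obtain ⟨l, rfl, t, ht, hr⟩ := h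
    exact hrest ht hr

end Compare

end StackLetter

/-! ### F_Rat consists of context-free languages. -/

open FiniteAutomaton PolycyclicMonoid StackLetter in
theorem PolycyclicMonoid.isContextFree_of_mem_familyRat {X α : Type*} [Nonempty X] [Finite α]
    {L : Language α} (hL : L ∈ familyRat (PolycyclicMonoid X) α) : L.IsContextFree := by
  obtain ⟨A, R, ⟨B, rfl⟩, rfl⟩ := hL
  obtain ⟨x⟩ := ‹Nonempty X›
  -- A trailing push and pop of the same letter make every spelling nonempty without changing its
  -- value.
  have hpad (l : List (StackLetter X α)) :
      value (l ++ [StackLetter.push x, StackLetter.pop x]) = value l := by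
    simp [letterValue, push_mul_pop, value]
  have hprod (l : List (StackLetter X α)) :
      (l.map fun b => (letterValue b, letterWord b)).prod =
        (value l, FreeMonoid.ofList (inputWord l)) := by
    induction l with
    | nil => rfl
    | cons b l ih => rw [List.map_cons, List.prod_cons, ih, value_cons]; rfl
  have hread (w : List α) : value (w.map (StackLetter.read (X := X))) = 1 ∧
      inputWord (w.map (StackLetter.read (X := X))) = w := by
    induction w with
    | nil => exact ⟨rfl, rfl⟩
    | cons a w ih => simpa [value_cons, letterValue] using ih
  obtain ⟨S, _, a, i, T, hA⟩ := A.exists_reaches (Λ := StackLetter X α)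
    (fun b => (letterValue b, letterWord b)) (by
      rintro ⟨m, w⟩
      obtain ⟨l, hl, hlw⟩ := exists_value_eq (α := α) m
      refine ⟨(l ++ w.toList.map StackLetter.read) ++ [StackLetter.push x, StackLetter.pop x],
        by simp, ?_⟩
      rw [hprod, hpad, value_append, hl, (hread _).1]
      simp [hlw, (hread _).2])
  obtain ⟨S', _, b, i', T', hB⟩ := B.exists_reaches (Λ := StackLetter X α) letterValue (by
      intro m
      obtain ⟨l, hl, -⟩ := exists_value_eq (α := α) m
      exact ⟨l ++ [StackLetter.push x, StackLetter.pop x], by simp, (hpad l).trans hl⟩)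
  have := CompareNT.finite S S'
  -- The proposition passed for `zero` says that the target automaton accepts a mismatching word; it
  -- does not depend on the input.
  have hG := DerivesWord.isContextFree (rule := CompareRule a b i i' T T'
    (∃ l, Mismatch l ∧ ∃ t' ∈ T', Reaches b i' l t')) 2 (fun _ _ h => h.length_le) .start
  refine Eq.mp (congrArg Language.IsContextFree (Set.ext fun w => ?_)) hG
  symm
  change (∃ m ∈ B.accepted, (m, FreeMonoid.ofList w) ∈ A.accepted) ↔ DerivesWord _ _ w
  simp only [hA, hB, hprod]
  constructor
  · rintro ⟨_, ⟨t', ht', l', hr', rfl⟩, t, ht, l, hr, h⟩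
    obtain ⟨h, hw⟩ := Prod.ext_iff.1 h
    refine CompareRule.derivesWord ⟨l, FreeMonoid.ofList.injective hw, ⟨t, ht, hr⟩, ?_⟩
    obtain ⟨h, h'⟩ | ⟨u, v, h, h'⟩ := value_eq_value_iff.1 h
    · exact .inl ⟨⟨l', h', t', ht', hr'⟩, h⟩
    · exact .inr ⟨u, v, l', h, h', t', ht', hr'⟩
  · intro h
    obtain ⟨l, rfl, ⟨t, ht, hr⟩, ⟨⟨l', hl', t', ht', hr'⟩, hl⟩ |
      ⟨u, v, l', hl, hl', t', ht', hr'⟩⟩ := DerivesWord.of_rewrite (fun _ _ h => h.sound) h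
    · exact ⟨_, ⟨t', ht', l', hr', rfl⟩, t, ht, l, hr,
        Prod.ext (value_eq_value_iff.2 (.inl ⟨hl, hl'⟩)) rfl⟩
    · exact ⟨_, ⟨t', ht', l', hr', rfl⟩, t, ht, l, hr,
        Prod.ext (value_eq_value_iff.2 (.inr ⟨u, v, hl, hl'⟩)) rfl⟩

/-! ### Context-free languages lie in F_1. -/

namespace PolycyclicMonoid

variable {X α : Type*}

/-- The element that pops the letters of `u` and then pushes those of `v`. -/
noncomputable def popPush (u v : List X) : PolycyclicMonoid X :=
  value (u.map (StackLetter.pop (α := Empty)) ++ v.map StackLetter.push)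

theorem acts_popPush {u v z y : List X} :
    Acts (popPush u v) z y ↔ ∃ w, z = w ++ u.reverse ∧ y = w ++ v :=
  acts_value_popsPushes (StackLetter.popsPushes_map_pop_append_map_push u v)

/-- The code word `x ^ n y`. -/
def codeWord (x y : X) (n : ℕ) : List X :=
  List.replicate n x ++ [y]

/-- The code is prefix-free, since `y` marks the end of each block of `x`. -/
theorem codeWord_append_inj {x y : X} (hxy : x ≠ y) {m n : ℕ} {v w : List X}
    (h : codeWord x y m ++ v = codeWord x y n ++ w) : m = n ∧ v = w := by
  induction m generalizing n with
  | zero => cases n <;> simp_all [codeWord, List.replicate_succ, eq_comm]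
  | succ m ih =>
    cases n with
    | zero => simp_all [codeWord, List.replicate_succ]
    | succ n =>
      have := ih (n := n) (by simpa [codeWord, List.replicate_succ] using h)
      simpa using this

/-- The encoding of a stack of symbols, its top first. -/
def encode {Γ : Type*} (x y : X) (f : Γ → ℕ) (s : List Γ) : List X :=
  s.flatMap fun σ => codeWord x y (f σ)

section encode

variable {Γ : Type*} {x y : X} {f : Γ → ℕ}

theorem encode_cons (σ : Γ) (s : List Γ) :
    encode x y f (σ :: s) = codeWord x y (f σ) ++ encode x y f s := rfl

theorem encode_append (s t : List Γ) :
    encode x y f (s ++ t) = encode x y f s ++ encode x y f t := by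
  simp [encode]

theorem encode_eq_nil {s : List Γ} (h : encode x y f s = []) : s = [] := by
  cases s with
  | nil => rfl
  | cons σ s => simp [encode_cons, codeWord] at h

/-- If a code word can be popped, then the symbol it encodes is the one on top. Injectivity on `K`
is enough as long as the stack contains only symbols of `K`. -/
theorem exists_of_encode_eq (hxy : x ≠ y) {K : Set Γ} (hf : K.InjOn f) {σ : Γ} (hσ : σ ∈ K)
    {s : List Γ} (hs : ∀ τ ∈ s, τ ∈ K) {w : List X}
    (h : encode x y f s = codeWord x y (f σ) ++ w) :
    ∃ t, s = σ :: t ∧ encode x y f t = w := by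
  cases s with
  | nil => simp [encode, codeWord] at h
  | cons τ t =>
    obtain ⟨h1, h2⟩ := codeWord_append_inj hxy h
    obtain rfl := hf (hs τ (by simp)) hσ h1
    exact ⟨t, rfl, h2⟩

end encode

/-- The edges of the automaton that simulates leftmost derivations of a grammar on its stack. -/
inductive LeftmostEdge (g : ContextFreeGrammar α) (x y : X) (f : Symbol α g.NT → ℕ) :
    Bool × (PolycyclicMonoid X × FreeMonoid α) × Bool → Prop
  | start : LeftmostEdge g x y f
      (false, (popPush [] (encode x y f [.nonterminal g.initial]).reverse, 1), true)
  | read (a : α) : LeftmostEdge g x y f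
      (true, (popPush (codeWord x y (f (.terminal a))) [], FreeMonoid.of a), true)
  | rule (r : ContextFreeRule α g.NT) (hr : r ∈ g.rules) : LeftmostEdge g x y f
      (true, (popPush (codeWord x y (f (.nonterminal r.input))) (encode x y f r.output).reverse,
        1), true)

theorem finite_leftmostEdge [Finite α] (g : ContextFreeGrammar α) (x y : X)
    (f : Symbol α g.NT → ℕ) : {e | LeftmostEdge g x y f e}.Finite := by
  refine (((Set.finite_singleton (false,
    (popPush [] (encode x y f [.nonterminal g.initial]).reverse, (1 : FreeMonoid α)), true)).union
    (Set.finite_range fun a : α =>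
      (true, (popPush (codeWord x y (f (.terminal a))) [], FreeMonoid.of a), true))).union
    (g.rules.finite_toSet.image fun r =>
      (true, (popPush (codeWord x y (f (.nonterminal r.input))) (encode x y f r.output).reverse,
        (1 : FreeMonoid α)), true))).subset ?_
  rintro _ (_ | a | ⟨r, hr⟩)
  · exact .inl (.inl rfl)
  · exact .inl (.inr ⟨a, rfl⟩)
  · exact .inr ⟨r, hr, rfl⟩

/-- The automaton that simulates leftmost derivations of a grammar on its stack. -/
noncomputable def leftmostAutomaton [Finite α] (g : ContextFreeGrammar α) (x y : X)
    (f : Symbol α g.NT → ℕ) : ValenceAutomaton (PolycyclicMonoid X) α where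
  V := Bool
  finite_V := inferInstance
  edges := (finite_leftmostEdge g x y f).toFinset
  init := false
  terminal := {true}

section leftmostAutomaton

variable [Finite α] {g : ContextFreeGrammar α} {x y : X} {f : Symbol α g.NT → ℕ}

theorem mem_edges_leftmostAutomaton
    {e : Bool × (PolycyclicMonoid X × FreeMonoid α) × Bool} :
    e ∈ (leftmostAutomaton g x y f).edges ↔ LeftmostEdge g x y f e :=
  (finite_leftmostEdge g x y f).mem_toFinset

-- The arbitrary stack `z` below the sentential form lets the paths for a right-hand side and for
-- the rest be concatenated.
open FiniteAutomaton in
theorem exists_hasPath_of_derivesWord {s : List (Symbol α g.NT)} {w : List α}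
    (h : DerivesWord (fun A u => ⟨A, u⟩ ∈ g.rules) s w) :
    ∃ m, (leftmostAutomaton g x y f).HasPath true (m, FreeMonoid.ofList w) true ∧
      ∀ z, Acts m (z ++ (encode x y f s).reverse) z := by
  induction h with
  | nil => exact ⟨1, .nil (A := leftmostAutomaton g x y f) true, by simp [acts_one, encode]⟩
  | terminal a _ ih =>
    obtain ⟨m, hm, hz⟩ := ih
    refine ⟨_, .cons (mem_edges_leftmostAutomaton.2 (.read a)) hm, fun z => acts_mul.2
      ⟨_, acts_popPush.2 ⟨_, ?_, rfl⟩, by simpa using hz z⟩⟩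
    simp [encode_cons]
  | @nonterminal A u s v w hr _ _ ihu ih =>
    obtain ⟨m, hm, hz⟩ := ihu
    obtain ⟨n, hn, hz'⟩ := ih
    have := HasPath.cons (mem_edges_leftmostAutomaton.2 (.rule _ hr)) (hm.trans hn)
    refine ⟨_, this, fun z => acts_mul.2
      ⟨_, acts_popPush.2 ⟨z ++ (encode x y f s).reverse, ?_, rfl⟩, acts_mul.2 ⟨_, hz _, hz' z⟩⟩⟩
    simp [encode_cons]

/-- By induction on the path: an edge can fire only if its symbol is on top, so it matches a
terminal or expands the leftmost nonterminal. The stack stays a code of symbols in `K`, and an empty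
final stack means an empty form. -/
theorem derivesWord_of_hasPath (hxy : x ≠ y) {K : Set (Symbol α g.NT)} (hf : K.InjOn f)
    (hterminal : ∀ a, .terminal a ∈ K)
    (hrule : ∀ r ∈ g.rules, .nonterminal r.input ∈ K ∧ ∀ σ ∈ r.output, σ ∈ K)
    {b c : (leftmostAutomaton g x y f).V} {p : PolycyclicMonoid X × FreeMonoid α}
    (h : (leftmostAutomaton g x y f).HasPath b p c) (hb : b = (true : Bool))
    {s : List (Symbol α g.NT)} (hs : ∀ σ ∈ s, σ ∈ K)
    (hp : Acts p.1 (encode x y f s).reverse []) :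
    DerivesWord (fun A u => ⟨A, u⟩ ∈ g.rules) s p.2.toList := by
  induction h generalizing s with
  | nil u =>
    have := acts_one.1 hp
    obtain rfl := encode_eq_nil (List.reverse_eq_nil_iff.1 this.symm)
    exact .nil
  | cons he _ ih =>
    have he := mem_edges_leftmostAutomaton.1 he
    subst hb
    cases he with
    | read a =>
      obtain ⟨k, hk, hk'⟩ := acts_mul.1 hp
      obtain ⟨w, hw, rfl⟩ := acts_popPush.1 hk
      obtain ⟨t, rfl, ht⟩ := exists_of_encode_eq hxy hf (hterminal a) hs
        (w := w.reverse) (by rw [← List.reverse_inj, hw]; simp)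
      refine (ih rfl (fun σ hσ => hs σ (by simp [hσ])) ?_).terminal a
      simpa [ht] using hk'
    | rule r hr =>
      obtain ⟨k, hk, hk'⟩ := acts_mul.1 hp
      obtain ⟨w, hw, rfl⟩ := acts_popPush.1 hk
      obtain ⟨t, rfl, ht⟩ := exists_of_encode_eq hxy hf (hrule r hr).1 hs
        (w := w.reverse) (by rw [← List.reverse_inj, hw]; simp)
      obtain ⟨w₁, w₂, hw, h₁, h₂⟩ := DerivesWord.exists_of_append
        (ih (s := r.output ++ t) rfl (fun σ hσ => (List.mem_append.1 hσ).elim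
          ((hrule r hr).2 σ) fun hσ => hs σ (by simp [hσ]))
          (by simpa [encode_append, ht] using hk'))
      have : FreeMonoid.toList (1 * _) = w₁ ++ w₂ := (congrArg _ (one_mul _)).trans hw
      exact this ▸ .nonterminal hr h₁ h₂

end leftmostAutomaton

theorem mem_familyOne_of_isContextFree [Nontrivial X] [Finite α] {L : Language α}
    (hL : L.IsContextFree) : L ∈ familyOne (PolycyclicMonoid X) α := by
  obtain ⟨g, rfl⟩ := hL
  obtain ⟨x, y, hxy⟩ := exists_pair_ne X
  -- `g.NT` may be infinite, so only the terminals and the nonterminals occurring in the grammar are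
  -- encoded.
  set K : Set (Symbol α g.NT) := Set.range .terminal ∪ {.nonterminal g.initial} ∪
    (⋃ r ∈ g.rules, ({.nonterminal r.input} ∪ {σ | σ ∈ r.output})) with hK
  have hfin : K.Finite := by
    refine ((Set.finite_range _).union (Set.finite_singleton _)).union
      (g.rules.finite_toSet.biUnion fun r _ => (Set.finite_singleton _).union ?_)
    exact List.finite_toSet _
  obtain ⟨f, hf⟩ := Set.countable_iff_exists_injOn.1 hfin.countable
  have hterminal (a : α) : .terminal a ∈ K := .inl (.inl ⟨a, rfl⟩)
  have hrule (r : ContextFreeRule α g.NT) (hr : r ∈ g.rules) :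
      .nonterminal r.input ∈ K ∧ ∀ σ ∈ r.output, σ ∈ K :=
    ⟨.inr (Set.mem_biUnion hr (.inl rfl)), fun σ hσ => .inr (Set.mem_biUnion hr (.inr hσ))⟩
  refine ⟨leftmostAutomaton g x y f, Set.ext fun w => ?_⟩
  refine Iff.trans ?_ (g.derives_map_terminal_iff (s := [.nonterminal g.initial])).symm
  constructor
  · rintro ⟨t, rfl, h⟩
    generalize hp : ((1 : PolycyclicMonoid X), FreeMonoid.ofList w) = p at h
    generalize ht : (true : Bool) = t at h
    generalize hi : (leftmostAutomaton g x y f).init = i at h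
    cases h with
    | nil => exact (Bool.false_ne_true (hi.trans ht.symm)).elim
    | @cons _ v _ m n he h =>
      subst hi ht
      cases mem_edges_leftmostAutomaton.1 he
      obtain ⟨h1, h2⟩ := Prod.ext_iff.1 hp
      -- Of the accepted value being 1, only its action on the empty stack is needed.
      obtain ⟨k, hk, hk'⟩ := acts_mul.1 ((congrArg (Acts · [] []) h1).mp (acts_one.2 rfl))
      obtain ⟨z, hz, rfl⟩ := acts_popPush.1 hk
      obtain rfl : z = [] := by simpa using hz
      have := derivesWord_of_hasPath hxy hf hterminal hrule h rfl
        (s := [.nonterminal g.initial]) (by simp [hK]) hk'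
      have hw : w = n.2.toList := h2.trans (one_mul _)
      exact hw ▸ this
  · intro h
    obtain ⟨m, hm, hz⟩ := exists_hasPath_of_derivesWord (x := x) (y := y) (f := f) h
    have := FiniteAutomaton.HasPath.cons (mem_edges_leftmostAutomaton.2 .start) hm
    refine ⟨true, rfl, ?_⟩
    refine Eq.mp (congrArg (FiniteAutomaton.HasPath _ _ · _) ?_) this
    refine Eq.symm (Prod.ext (ext_acts fun z u => ?_) (one_mul (FreeMonoid.ofList w)).symm)
    have key : Acts (popPush [] (encode x y f [.nonterminal g.initial]).reverse * m) z z :=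
      acts_mul.2 ⟨_, acts_popPush.2 ⟨z, by simp, rfl⟩, hz z⟩
    -- The path value fixes every stack `z`, and a partial map has at most one image, so it is the
    -- identity.
    exact acts_one.trans ⟨fun h => h ▸ key, fun h => Acts.unique h key⟩

end PolycyclicMonoid

/-! ### F_1 lies in F_Rat, and the theorem. -/

theorem isRationalSubset_singleton_one (M : Type*) [Monoid M] :
    IsRationalSubset ({1} : Set M) := by
  refine ⟨⟨Unit, inferInstance, ∅, (), {()}⟩, Set.ext fun m => ⟨?_, ?_⟩⟩
  · rintro ⟨_, -, h⟩
    cases h with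
    | nil => rfl
    | cons he => simp at he
  · rintro rfl
    exact ⟨(), rfl, .nil _⟩

theorem familyOne_subset_familyRat (M : Type*) [Monoid M] (α : Type*) :
    familyOne M α ⊆ familyRat M α := by
  rintro _ ⟨A, rfl⟩
  refine ⟨A, {1}, isRationalSubset_singleton_one M, Set.ext fun w => ?_⟩
  exact ⟨by rintro ⟨_, rfl, hw⟩; exact hw, fun hw => ⟨1, rfl, hw⟩⟩

theorem mainTheorem1 {X : Type*} [Nontrivial X] {α : Type*} [Finite α] :
    familyRat (PolycyclicMonoid X) α = {L : Language α | L.IsContextFree} ∧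
      familyOne (PolycyclicMonoid X) α = {L : Language α | L.IsContextFree} := by
  have h₁ : familyRat (PolycyclicMonoid X) α ⊆ {L : Language α | L.IsContextFree} :=
    fun _ => PolycyclicMonoid.isContextFree_of_mem_familyRat
  have h₂ : {L : Language α | L.IsContextFree} ⊆ familyOne (PolycyclicMonoid X) α :=
    fun _ => PolycyclicMonoid.mem_familyOne_of_isContextFree
  have h₃ := familyOne_subset_familyRat (PolycyclicMonoid X) α
  exact ⟨h₁.antisymm (h₂.trans h₃), (h₃.trans h₁).antisymm h₂⟩
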